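/- Let $K$ be a field, let $A$ be an associative unital $K$-algebra and let $a_1,\dots,a_n\in A$ be such that the ordered monomials $a^{\alpha}=a_1^{\alpha_1}\cdots a_n^{\alpha_n}$, $\alpha=(\alpha_1,\dots,\alpha_n)\in\mathbb{N}^n$, form a $K$-basis $\mathcal{B}$ of $A$ (a PBW basis). For a total ordering $\prec$ on $\mathcal{B}$ and $f\in A\setminus\{0\}$ let $\mathbf{LM}(f)$ denote the $\prec$-largest monomial that occurs in $f$ with nonzero coefficient, and put $\mathbf{LM}(0)=0$. Call $\prec$ a monomial ordering on $\mathcal{B}$ if 1. $\prec$ is a well-ordering; 2. for all $a^{\gamma},a^{\alpha},a^{\beta},a^{\eta}\in\mathcal{B}$: if $a^{\gamma}\ne 1$, $a^{\beta}\ne a^{\gamma}$ and $a^{\gamma}=\mathbf{LM}(a^{\alpha}a^{\beta}a^{\eta})$, then $a^{\beta}\prec a^{\gamma}$; 3. for all $a^{\gamma},a^{\alpha},a^{\beta},a^{\eta}\in\mathcal{B}$: if $a^{\alpha}\prec a^{\beta}$, $\mathbf{LM}(a^{\gamma}a^{\alpha}a^{\eta})\ne 0$ and $\mathbf{LM}(a^{\gamma}a^{\beta}a^{\eta})\notin\{0,1\}$,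 then $\mathbf{LM}(a^{\gamma}a^{\alpha}a^{\eta})\prec\mathbf{LM}(a^{\gamma}a^{\beta}a^{\eta})$. Assume that $A=K[a_1,\dots,a_n]$ is a solvable polynomial algebra with admissible system $(\mathcal{B},\prec)$, that is, $\prec$ is a monomial ordering on $\mathcal{B}$ and for all $\alpha,\beta\in\mathbb{N}^n$ one has $a^{\alpha}a^{\beta}=\lambda_{\alpha,\beta}a^{\alpha+\beta}+f_{\alpha,\beta}$ with $\lambda_{\alpha,\beta}\in K\setminus\{0\}$ and $f_{\alpha,\beta}\in A$ such that $\mathbf{LM}(f_{\alpha,\beta})\prec a^{\alpha+\beta}$ if $f_{\alpha,\beta}\neq 0$. Theorem (noncommutative Hilbert syzygy theorem). Every finitely generated left $A$-module $M$ has a finite free resolution of length at most $n$: there are $q\le n$, finitely generated free left $A$-modules $L_0,\dots,L_q$ and $A$-linear maps $\varphi_i$ such that $$0\longrightarrow L_q\xrightarrow{\varphi_q}L_{q-1}\xrightarrow{\varphi_{q-1}}\cdots\xrightarrow{\varphi_1}L_0\xrightarrow{\varphi_0}M\longrightarrow 0$$ is exact. -/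

import Mathlib

open Module

universe u v w

/-- The standard monomial `a^α = a₁^{α₁} ⋯ aₙ^{αₙ}` (ordered product) of a tuple `a` of
elements of a ring. -/
def pbwMonomial {A : Type*} [Ring A] {n : ℕ} (a : Fin n → A) (α : Fin n → ℕ) : A :=
  (List.ofFn fun i => a i ^ α i).prod

/-- `b` is the PBW `K`-basis of `A` attached to the generators `a`: the standard monomials
`a^α`, indexed by `α ∈ ℕⁿ`, form a `K`-basis of `A`, namely `b`. -/
def IsPBWBasis {K A : Type*} [Field K] [Ring A] [Algebra K A] {n : ℕ}
    (a : Fin n → A) (b : Basis (Fin n → ℕ) K A) : Prop :=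
  ∀ α, b α = pbwMonomial a α

/-- `b γ` is the leading monomial of `f` with respect to the ordering `prec` of the monomials
(which are labelled by their exponents): it occurs in `f`, and all other monomials
of `f` are smaller. No `γ` has this property when `f = 0`. -/
def IsLeadingMonomial {K A : Type*} [Field K] [Ring A] [Algebra K A] {n : ℕ}
    (b : Basis (Fin n → ℕ) K A) (prec : (Fin n → ℕ) → (Fin n → ℕ) → Prop)
    (f : A) (γ : Fin n → ℕ) : Prop :=
  b.repr f γ ≠ 0 ∧ ∀ δ, b.repr f δ ≠ 0 → δ ≠ γ → prec δ γ

/-- `prec` is a (two-sided) monomial ordering on the PBW basis `b`; the monomial `1` is the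
one of exponent `0`. -/
structure IsMonomialOrdering {K A : Type*} [Field K] [Ring A] [Algebra K A] {n : ℕ}
    (b : Basis (Fin n → ℕ) K A) (prec : (Fin n → ℕ) → (Fin n → ℕ) → Prop) : Prop where
  /-- `prec` is a (strict) total well-ordering. -/
  isWellOrder : IsWellOrder (Fin n → ℕ) prec
  /-- If `a^γ ≠ 1`, `a^β ≠ a^γ` and `a^γ = LM(a^α a^β a^η)`, then `a^β ≺ a^γ`. -/
  prec_of_leadingMonomial : ∀ γ α β η : Fin n → ℕ, γ ≠ 0 → β ≠ γ →
    IsLeadingMonomial b prec (b α * b β * b η) γ → prec β γ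
  /-- If `a^α ≺ a^β`, `LM(a^γ a^α a^η) ≠ 0` and `LM(a^γ a^β a^η) ∉ {0, 1}`,
  then `LM(a^γ a^α a^η) ≺ LM(a^γ a^β a^η)`. -/
  mul_prec_mul : ∀ γ α β η μ ν : Fin n → ℕ, prec α β →
    IsLeadingMonomial b prec (b γ * b α * b η) μ →
    IsLeadingMonomial b prec (b γ * b β * b η) ν → ν ≠ 0 → prec μ ν

/-- `A = K[a₁, …, aₙ]` is a solvable polynomial algebra with admissible system `(b, prec)`. -/
structure IsSolvablePolynomialAlgebra {K A : Type*} [Field K] [Ring A] [Algebra K A] {n : ℕ}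
    (a : Fin n → A) (b : Basis (Fin n → ℕ) K A)
    (prec : (Fin n → ℕ) → (Fin n → ℕ) → Prop) : Prop where
  /-- `A` has the PBW basis `b`. -/
  isPBWBasis : IsPBWBasis a b
  /-- `prec` is a monomial ordering on it. -/
  isMonomialOrdering : IsMonomialOrdering b prec
  /-- `a^α a^β = c a^{α+β} + f` with `c ∈ K` nonzero, and `LM(f) ≺ a^{α+β}` if `f ≠ 0`. -/
  mul_eq : ∀ α β : Fin n → ℕ, ∃ (c : K) (f : A), c ≠ 0 ∧
    b α * b β = c • b (α + β) + f ∧ ∀ γ, IsLeadingMonomial b prec f γ → prec γ (α + β)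

/-- A finite free resolution `0 → L_q → ⋯ → L₁ → L₀ → M → 0` of the left `A`-module `M`:
an exact sequence in which all `L i` are free and finitely generated, and `L i = 0`
for `i > q`. -/
structure FiniteFreeResolution (A : Type*) [Ring A] (M : Type*) [AddCommGroup M] [Module A M]
    (q : ℕ) where
  /-- The modules of the resolution. -/
  L : ℕ → Type*
  [addCommGroup : ∀ i, AddCommGroup (L i)]
  [module : ∀ i, Module A (L i)]
  free : ∀ i, Module.Free A (L i)
  finite : ∀ i, Module.Finite A (L i)
  /-- The map `φ₀ : L₀ → M`. -/
  augmentation : L 0 →ₗ[A] M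
  /-- The maps `φ_{i+1} : L_{i+1} → L_i`. -/
  d : ∀ i, L (i + 1) →ₗ[A] L i
  augmentation_surjective : Function.Surjective augmentation
  exact_zero : Function.Exact (d 0) augmentation
  exact_succ : ∀ i, Function.Exact (d (i + 1)) (d i)
  eq_zero : ∀ i, q < i → Subsingleton (L i)

/-! This is Schreyer's proof of the syzygy theorem. Since `LM(a^α a^β) = a^{α+β}`, leading exponents
behave as over a commutative polynomial ring: Gröbner bases of submodules of `A^s` exist by
Dickson's lemma and division by them works. Noncommutativity enters nowhere else.

Write `M = A^s / N` and take iterated syzygies of Gröbner bases. Rank the monomials `a^α e_j` of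
`A^m` by the leading index of `a^α g_j`, ties going to the generator whose leading exponent is
larger in variable `k`. A leading index of a syzygy then comes from an overlap in which the leading
generator already has the larger `k`-th exponent, so its multiplier needs no power of that variable
(`mem_leadSet_ker`, `mem_leadSet_ker_of_leadShift_eq`). Each step thus frees the minimal leading
exponents of one more variable. Once a single variable is left, each component carries at most one
minimal generator, no overlaps exist, and the module is free
(`nonempty_finiteFreeResolution_of_clearBelow`). -/

namespace FiniteFreeResolution

/-! ### Assembling free resolutions -/

variable {A : Type v} [Ring A]

/-- The modules `A^m, 0, 0, …`. -/
def freeSeq (A : Type v) (m : ℕ) : ℕ → Type v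
  | 0 => Fin m → A
  | _ + 1 => PUnit.{v + 1}

instance freeSeqAddCommGroup (m : ℕ) : ∀ i, AddCommGroup (freeSeq A m i)
  | 0 => inferInstanceAs (AddCommGroup (Fin m → A))
  | _ + 1 => inferInstanceAs (AddCommGroup PUnit.{v + 1})

instance freeSeqModule (m : ℕ) : ∀ i, Module A (freeSeq A m i)
  | 0 => inferInstanceAs (Module A (Fin m → A))
  | _ + 1 => inferInstanceAs (Module A PUnit.{v + 1})

/-- The resolution of length `0` of a finitely generated free module. -/
noncomputable def ofEquiv {M : Type w} [AddCommGroup M] [Module A M] {m : ℕ}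
    (e : (Fin m → A) ≃ₗ[A] M) : FiniteFreeResolution.{v, w, v} A M 0 where
  L := freeSeq A m
  free
    | 0 => inferInstanceAs (Module.Free A (Fin m → A))
    | _ + 1 => inferInstanceAs (Module.Free A PUnit.{v + 1})
  finite
    | 0 => inferInstanceAs (Module.Finite A (Fin m → A))
    | _ + 1 => inferInstanceAs (Module.Finite A PUnit.{v + 1})
  augmentation := e.toLinearMap
  d _ := 0
  augmentation_surjective := e.surjective
  exact_zero x := by
    constructor
    · intro h
      exact ⟨0, ((map_eq_zero_iff e e.injective).1 h).symm⟩
    · rintro ⟨y, rfl⟩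
      exact map_zero e
  exact_succ _ x := ⟨fun _ => ⟨0, rfl⟩, fun _ => rfl⟩
  eq_zero
    | 0, h => absurd h (lt_irrefl 0)
    | _ + 1, _ => inferInstanceAs (Subsingleton PUnit.{v + 1})

/-- The modules `A^m, L₀, L₁, …`. -/
def consSeq (A : Type v) (m : ℕ) (L : ℕ → Type v) : ℕ → Type v
  | 0 => Fin m → A
  | i + 1 => L i

instance consSeqAddCommGroup (m : ℕ) (L : ℕ → Type v) [∀ i, AddCommGroup (L i)] :
    ∀ i, AddCommGroup (consSeq A m L i)
  | 0 => inferInstanceAs (AddCommGroup (Fin m → A))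
  | i + 1 => inferInstanceAs (AddCommGroup (L i))

instance consSeqModule (m : ℕ) (L : ℕ → Type v) [∀ i, AddCommGroup (L i)]
    [∀ i, Module A (L i)] : ∀ i, Module A (consSeq A m L i)
  | 0 => inferInstanceAs (Module A (Fin m → A))
  | i + 1 => inferInstanceAs (Module A (L i))

attribute [local instance] FiniteFreeResolution.addCommGroup FiniteFreeResolution.module

/-- A resolution of the kernel of a surjection `A^m → M` extends to a resolution of `M`. -/
noncomputable def cons {M : Type w} [AddCommGroup M] [Module A M] {m q : ℕ}
    (f : (Fin m → A) →ₗ[A] M) (hf : Function.Surjective f)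
    (R : FiniteFreeResolution.{v, v, v} A (LinearMap.ker f) q) :
    FiniteFreeResolution.{v, w, v} A M (q + 1) where
  L := consSeq A m R.L
  free
    | 0 => inferInstanceAs (Module.Free A (Fin m → A))
    | i + 1 => R.free i
  finite
    | 0 => inferInstanceAs (Module.Finite A (Fin m → A))
    | i + 1 => R.finite i
  augmentation := f
  d
    | 0 => (LinearMap.ker f).subtype ∘ₗ R.augmentation
    | i + 1 => R.d i
  augmentation_surjective := hf
  exact_zero x := by
    constructor
    · intro h
      obtain ⟨y, hy⟩ := R.augmentation_surjective ⟨x, h⟩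
      exact ⟨y, congrArg Subtype.val hy⟩
    · rintro ⟨y, rfl⟩
      exact (R.augmentation y).2
  exact_succ
    | 0 => fun x => by
      refine Iff.trans ?_ (R.exact_zero x)
      exact Submodule.coe_eq_zero (p := LinearMap.ker f) (x := R.augmentation x)
    | i + 1 => R.exact_succ i
  eq_zero
    | 0, h => absurd h (Nat.not_lt_zero _)
    | i + 1, h => R.eq_zero i (Nat.lt_of_succ_lt_succ h)

end FiniteFreeResolution

namespace FiniteFreeResolution

/-- Transport of a resolution along an isomorphism of the resolved modules. -/
noncomputable def congr {A : Type v} [Ring A] {M : Type w} {N : Type w} [AddCommGroup M]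
    [Module A M] [AddCommGroup N] [Module A N] {q : ℕ} (e : M ≃ₗ[A] N)
    (R : FiniteFreeResolution.{v, w, v} A M q) : FiniteFreeResolution.{v, w, v} A N q where
  L := R.L
  addCommGroup := R.addCommGroup
  module := R.module
  free := R.free
  finite := R.finite
  augmentation :=
    letI := R.addCommGroup
    letI := R.module
    e.toLinearMap ∘ₗ R.augmentation
  d := R.d
  augmentation_surjective := e.surjective.comp R.augmentation_surjective
  exact_zero x := Iff.trans (map_eq_zero_iff e e.injective) (R.exact_zero x)
  exact_succ := R.exact_succ
  eq_zero := R.eq_zero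

end FiniteFreeResolution

/-! ### Leading indices with respect to a ranked basis -/

/-- `x` is the leading index of `f`: it occurs in `f` and has the largest rank `ρ`. -/
def IsLead {K L X Ω : Type*} [Field K] [AddCommGroup L] [Module K L] [LinearOrder Ω]
    (B : Basis X K L) (ρ : X → Ω) (f : L) (x : X) : Prop :=
  B.repr f x ≠ 0 ∧ ∀ y, B.repr f y ≠ 0 → ρ y ≤ ρ x

section Lead

variable {K L X Ω : Type*} [Field K] [AddCommGroup L] [Module K L] [LinearOrder Ω]
  {B : Basis X K L} {ρ : X → Ω}

theorem exists_isLead {f : L} (hf : f ≠ 0) : ∃ x, IsLead B ρ f x := by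
  have hne : (B.repr f).support.Nonempty := by
    rw [Finsupp.support_nonempty_iff]
    exact fun h => hf ((map_eq_zero_iff B.repr B.repr.injective).1 h)
  obtain ⟨x, hx, h⟩ := Finset.exists_max_image _ ρ hne
  exact ⟨x, Finsupp.mem_support_iff.1 hx, fun y hy => h y (Finsupp.mem_support_iff.2 hy)⟩

theorem isLead_basis (x : X) : IsLead B ρ (B x) x := by
  classical
  refine ⟨by simp, fun y hy => ?_⟩
  rw [Basis.repr_self, Finsupp.single_apply] at hy
  have : x = y := by by_contra h; exact hy (if_neg h)
  rw [this]

theorem exists_of_repr_map_ne_zero {X' L' : Type*} [AddCommGroup L'] [Module K L']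
    (B' : Basis X' K L') (T : L' →ₗ[K] L) {f : L'} {y : X} (hy : B.repr (T f) y ≠ 0) :
    ∃ z, B'.repr f z ≠ 0 ∧ B.repr (T (B' z)) y ≠ 0 := by
  by_contra! H
  apply hy
  conv_lhs => rw [← B'.linearCombination_repr f, Finsupp.linearCombination_apply, Finsupp.sum]
  simp only [map_sum, map_smul, Finsupp.coe_finsetSum, Finset.sum_apply, Finsupp.smul_apply,
    smul_eq_mul]
  exact Finset.sum_eq_zero fun z hz => by rw [H z (Finsupp.mem_support_iff.1 hz), mul_zero]

/-- The image of one term strictly dominates the images of all others, so its top cannot cancel.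
This serves both multiplication by a monomial and the map sending `e_j` to `g_j`. -/
theorem isLead_map {X' L' : Type*} [AddCommGroup L'] [Module K L']
    (B' : Basis X' K L') (T : L' →ₗ[K] L) (σ : X' → X)
    (hT : ∀ z, IsLead B ρ (T (B' z)) (σ z)) {f : L'} {z : X'} (hz : B'.repr f z ≠ 0)
    (hlt : ∀ z', B'.repr f z' ≠ 0 → z' ≠ z → ρ (σ z') < ρ (σ z)) :
    IsLead B ρ (T f) (σ z) := by
  set g := f - B'.repr f z • B' z with hg
  have hgz : ∀ z', B'.repr g z' ≠ 0 → ρ (σ z') < ρ (σ z) := by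
    classical
    intro z' h
    have key : B'.repr g z' = B'.repr f z' - B'.repr f z * (if z = z' then 1 else 0) := by
      simp [hg, Finsupp.single_apply]
    rw [key] at h
    by_cases e : z' = z
    · subst e; simp at h
    · rw [if_neg (Ne.symm e), mul_zero, sub_zero] at h
      exact hlt z' h e
  have hlow : ∀ y, B.repr (T g) y ≠ 0 → ρ y < ρ (σ z) := by
    intro y hy
    obtain ⟨z', h1, h2⟩ := exists_of_repr_map_ne_zero B' T hy
    exact ((hT z').2 y h2).trans_lt (hgz z' h1)
  have hf : ∀ y, B.repr (T f) y = B.repr (T g) y + B'.repr f z * B.repr (T (B' z)) y := by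
    intro y; simp [hg]
  refine ⟨?_, fun y hy => ?_⟩
  · have h0 : B.repr (T g) (σ z) = 0 := by
      by_contra h; exact lt_irrefl _ (hlow _ h)
    rw [hf, h0, zero_add]
    exact mul_ne_zero hz (hT z).1
  · by_cases h : B.repr (T g) y = 0
    · rw [hf, h, zero_add] at hy
      exact (hT z).2 y (right_ne_zero_of_mul hy)
    · exact (hlow y h).le

/-- Cancelling leading terms. -/
theorem exists_sub_smul (hρ : Function.Injective ρ) {f g : L} {x : X} (hf : IsLead B ρ f x)
    (hg : IsLead B ρ g x) :
    ∃ c : K, ∀ y, B.repr (f - c • g) y ≠ 0 → ρ y < ρ x := by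
  refine ⟨B.repr f x / B.repr g x, fun y hy => ?_⟩
  have h : B.repr (f - (B.repr f x / B.repr g x) • g) y
      = B.repr f y - B.repr f x / B.repr g x * B.repr g y := by simp
  rw [h] at hy
  have hle : ρ y ≤ ρ x := by
    by_cases h1 : B.repr f y = 0
    · rw [h1, zero_sub, neg_ne_zero] at hy
      exact hg.2 y (right_ne_zero_of_mul hy)
    · exact hf.2 y h1
  refine lt_of_le_of_ne hle fun e => hy ?_
  rw [hρ e, div_mul_cancel₀ _ hg.1, sub_self]

end Lead

/-! ### Leading monomials in a solvable polynomial algebra -/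

section Solvable

variable {K : Type u} [Field K] {A : Type v} [Ring A] [Algebra K A] {n : ℕ}
  {b : Basis (Fin n → ℕ) K A} {prec : (Fin n → ℕ) → (Fin n → ℕ) → Prop}

theorem rank_lt_rank_iff [IsWellOrder (Fin n → ℕ) prec] {α β : Fin n → ℕ} :
    IsWellFounded.rank prec α < IsWellFounded.rank prec β ↔ prec α β := by
  refine ⟨fun h => ?_, IsWellFounded.rank_lt_of_rel⟩
  rcases trichotomous_of prec α β with h1 | rfl | h1
  · exact h1
  · exact absurd h (lt_irrefl _)
  · exact absurd h (IsWellFounded.rank_lt_of_rel h1).asymm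

theorem rank_injective [IsWellOrder (Fin n → ℕ) prec] :
    Function.Injective (IsWellFounded.rank prec) := by
  intro α β h
  rcases trichotomous_of prec α β with h1 | h1 | h1
  · exact absurd h (IsWellFounded.rank_lt_of_rel h1).ne
  · exact h1
  · exact absurd h (IsWellFounded.rank_lt_of_rel h1).ne'

theorem isLeadingMonomial_iff_isLead [IsWellOrder (Fin n → ℕ) prec] {f : A} {γ : Fin n → ℕ} :
    IsLeadingMonomial b prec f γ ↔ IsLead b (IsWellFounded.rank prec) f γ := by
  refine and_congr_right fun _ => forall_congr' fun δ => imp_congr_right fun _ => ?_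
  rw [← rank_lt_rank_iff (prec := prec), le_iff_lt_or_eq, rank_injective.eq_iff]
  by_cases h : δ = γ <;> simp [h]

namespace IsSolvablePolynomialAlgebra

variable {a : Fin n → A} (hA : IsSolvablePolynomialAlgebra a b prec)

include hA

theorem basis_zero : b 0 = 1 := by
  simp [hA.isPBWBasis 0, pbwMonomial]

theorem isLeadingMonomial_basis (γ : Fin n → ℕ) : IsLeadingMonomial b prec (b γ) γ := by
  have := hA.isMonomialOrdering.isWellOrder
  exact isLeadingMonomial_iff_isLead.2 (isLead_basis γ)

theorem zero_prec {γ : Fin n → ℕ} (hγ : γ ≠ 0) : prec 0 γ := by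
  -- Read `a^γ` as the leading monomial of `a^γ · 1 · 1`.
  refine hA.isMonomialOrdering.prec_of_leadingMonomial γ γ 0 0 hγ hγ.symm ?_
  rw [hA.basis_zero, mul_one, mul_one]
  exact hA.isLeadingMonomial_basis γ

theorem isLeadingMonomial_mul (α β : Fin n → ℕ) :
    IsLeadingMonomial b prec (b α * b β) (α + β) := by
  have := hA.isMonomialOrdering.isWellOrder
  obtain ⟨c, f, hc, he, hf⟩ := hA.mul_eq α β
  have hlow : ∀ δ, b.repr f δ ≠ 0 → prec δ (α + β) := by
    intro δ hδ
    have hf0 : f ≠ 0 := by rintro rfl; simp at hδ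
    obtain ⟨γ, hγ⟩ := exists_isLead (B := b) (ρ := IsWellFounded.rank prec) hf0
    rw [← rank_lt_rank_iff (prec := prec)]
    exact (hγ.2 δ hδ).trans_lt (rank_lt_rank_iff.2 (hf γ (isLeadingMonomial_iff_isLead.2 hγ)))
  have h0 : b.repr f (α + β) = 0 := by
    by_contra h; exact irrefl_of prec _ (hlow _ h)
  refine ⟨by simp [he, h0, hc], fun δ hδ hne => hlow δ ?_⟩
  rw [he] at hδ
  simpa [Finsupp.single_apply, hne.symm] using hδ

theorem add_prec_add (γ : Fin n → ℕ) {α β : Fin n → ℕ} (h : prec α β) :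
    prec (γ + α) (γ + β) := by
  have := hA.isMonomialOrdering.isWellOrder
  refine hA.isMonomialOrdering.mul_prec_mul γ α β 0 (γ + α) (γ + β) h ?_ ?_ ?_
  · rw [hA.basis_zero, mul_one]; exact hA.isLeadingMonomial_mul γ α
  · rw [hA.basis_zero, mul_one]; exact hA.isLeadingMonomial_mul γ β
  -- The axiom excludes the leading monomial `1`; here that would force `β = 0`, which has nothing
  -- below it.
  · intro h0
    have hβ : β = 0 := (add_eq_zero.1 h0).2
    subst hβ
    have hα : α ≠ 0 := by rintro rfl; exact irrefl_of prec _ h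
    exact asymm_of prec h (hA.zero_prec hα)

end IsSolvablePolynomialAlgebra

/-! ### Monomials of free modules -/

/-- The `K`-basis of `A^s` that consists of the monomials `a^α e_i`. -/
noncomputable def monomialBasis (b : Basis (Fin n → ℕ) K A) (s : ℕ) :
    Basis ((Fin n → ℕ) × Fin s) K (Fin s → A) :=
  (Pi.basis fun _ : Fin s => b).reindex ((Equiv.sigmaEquivProd _ _).trans (Equiv.prodComm _ _))

theorem monomialBasis_repr (s : ℕ) (f : Fin s → A) (x : (Fin n → ℕ) × Fin s) :
    (monomialBasis b s).repr f x = b.repr (f x.2) x.1 := by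
  rw [monomialBasis, Basis.repr_reindex_apply]
  exact Pi.basis_repr _ _ _

theorem monomialBasis_apply (s : ℕ) (x : (Fin n → ℕ) × Fin s) :
    monomialBasis b s x = Pi.single x.2 (b x.1) := by
  simp [monomialBasis]

/-- `ρ` ranks the monomials of `A^s` compatibly with `prec` and with multiplication. -/
structure IsModuleRanking (prec : (Fin n → ℕ) → (Fin n → ℕ) → Prop) {s : ℕ} {Ω : Type*}
    [LinearOrder Ω] (ρ : (Fin n → ℕ) × Fin s → Ω) : Prop where
  injective : Function.Injective ρ
  add_lt : ∀ γ x y, ρ x < ρ y → ρ (γ + x.1, x.2) < ρ (γ + y.1, y.2)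
  lt_of_prec : ∀ α β i, prec α β → ρ (α, i) < ρ (β, i)

theorem isLead_smul {a : Fin n → A} (hA : IsSolvablePolynomialAlgebra a b prec) {s : ℕ}
    {Ω : Type*} [LinearOrder Ω] {ρ : (Fin n → ℕ) × Fin s → Ω} (hρ : IsModuleRanking prec ρ)
    (γ : Fin n → ℕ) {f : Fin s → A} {x : (Fin n → ℕ) × Fin s}
    (hf : IsLead (monomialBasis b s) ρ f x) :
    IsLead (monomialBasis b s) ρ (b γ • f) (γ + x.1, x.2) := by
  refine isLead_map (monomialBasis b s) (Algebra.lsmul K K (Fin s → A) (b γ))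
    (fun x => (γ + x.1, x.2)) (fun z => ?_) hf.1
    (fun z' h hne => hρ.add_lt γ _ _ (lt_of_le_of_ne (hf.2 z' h) (hρ.injective.ne hne)))
  have h := hA.isLeadingMonomial_mul γ z.1
  have e : Algebra.lsmul K K (Fin s → A) (b γ) (monomialBasis b s z)
      = Pi.single z.2 (b γ * b z.1) := by
    rw [monomialBasis_apply, Algebra.lsmul_coe, ← smul_eq_mul, Pi.single_smul]
  rw [e]
  refine ⟨by rw [monomialBasis_repr]; simpa using h.1, ?_⟩
  rintro ⟨δ, j⟩ hy
  rw [monomialBasis_repr] at hy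
  have hj : j = z.2 := by
    by_contra hj; simp [Pi.single_eq_of_ne hj] at hy
  subst hj
  rw [Pi.single_eq_same] at hy
  by_cases hδ : δ = γ + z.1
  · rw [hδ]
  · exact (hρ.lt_of_prec _ _ _ (h.2 δ hy hδ)).le

/-! ### Gröbner bases and division -/

/-- The leading indices of the elements of a submodule of `A^s`. -/
def leadSet (b : Basis (Fin n → ℕ) K A) {s : ℕ} {Ω : Type*} [LinearOrder Ω]
    (ρ : (Fin n → ℕ) × Fin s → Ω) (N : Submodule A (Fin s → A)) : Set ((Fin n → ℕ) × Fin s) :=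
  {y | ∃ f ∈ N, IsLead (monomialBasis b s) ρ f y}

/-- The index of the leading monomial of `a^α g_j`, where `g_j` has leading index `x j`. -/
def leadShift {s m : ℕ} (x : Fin m → (Fin n → ℕ) × Fin s) (z : (Fin n → ℕ) × Fin m) :
    (Fin n → ℕ) × Fin s :=
  (z.1 + (x z.2).1, (x z.2).2)

/-- `g` is a Gröbner basis of `N` and `x` lists its leading indices. -/
structure IsGroebnerBasis (b : Basis (Fin n → ℕ) K A) {s m : ℕ} {Ω : Type*} [LinearOrder Ω]
    (ρ : (Fin n → ℕ) × Fin s → Ω) (N : Submodule A (Fin s → A)) (g : Fin m → Fin s → A)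
    (x : Fin m → (Fin n → ℕ) × Fin s) : Prop where
  mem : ∀ j, g j ∈ N
  isLead : ∀ j, IsLead (monomialBasis b s) ρ (g j) (x j)
  exists_leadShift : ∀ y ∈ leadSet b ρ N, ∃ z, leadShift x z = y

/-- Minimal Gröbner bases exist, by Dickson's lemma. -/
theorem exists_isGroebnerBasis {s : ℕ} {Ω : Type*} [LinearOrder Ω]
    (ρ : (Fin n → ℕ) × Fin s → Ω) (N : Submodule A (Fin s → A)) :
    ∃ (m : ℕ) (g : Fin m → Fin s → A) (x : Fin m → (Fin n → ℕ) × Fin s),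
      IsGroebnerBasis b ρ N g x ∧ Function.Injective x ∧
      ∀ j, Minimal (fun α => (α, (x j).2) ∈ leadSet b ρ N) (x j).1 := by
  set G : Set ((Fin n → ℕ) × Fin s) :=
    {y | Minimal (fun α => (α, y.2) ∈ leadSet b ρ N) y.1} with hG
  have hfin : G.Finite := by
    -- Minimal exponents form an antichain in the well-quasi-order `ℕⁿ`.
    have h : ∀ i : Fin s, {α | Minimal (fun α => (α, i) ∈ leadSet b ρ N) α}.Finite := fun i =>
      WellQuasiOrderedLE.finite_of_isAntichain fun α hα β hβ hne hle =>
        hne (le_antisymm hle (hβ.2 hα.1 hle))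
    refine (Set.finite_iUnion fun i => (h i).image fun α => (α, i)).subset ?_
    rintro ⟨α, i⟩ hα
    exact Set.mem_iUnion.2 ⟨i, α, hα, rfl⟩
  have := hfin.fintype
  let e := Fintype.equivFin G
  have hx : ∀ j, Minimal (fun α => (α, (e.symm j).1.2) ∈ leadSet b ρ N) (e.symm j).1.1 :=
    fun j => (e.symm j).2
  choose g hgN hg using fun j => (hx j).1
  refine ⟨_, g, fun j => (e.symm j).1, ⟨hgN, hg, ?_⟩,
    Subtype.val_injective.comp e.symm.injective, hx⟩
  rintro ⟨α, i⟩ hy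
  obtain ⟨β, hβ, hmin⟩ :=
    exists_minimal_le_of_wellFoundedLT (fun α => (α, i) ∈ leadSet b ρ N) α hy
  refine ⟨(α - β, e ⟨(β, i), hmin⟩), ?_⟩
  simp [leadShift, tsub_add_cancel_of_le hβ]

section Groebner

variable {a : Fin n → A} {s m : ℕ} {Ω : Type*} [LinearOrder Ω]
  {ρ : (Fin n → ℕ) × Fin s → Ω} {N : Submodule A (Fin s → A)} {g : Fin m → Fin s → A}
  {x : Fin m → (Fin n → ℕ) × Fin s}

theorem linearCombination_monomialBasis (z : (Fin n → ℕ) × Fin m) :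
    Fintype.linearCombination A g (monomialBasis b m z) = b z.1 • g z.2 := by
  rw [monomialBasis_apply, Fintype.linearCombination_apply_single]

theorem IsGroebnerBasis.isLead_linearCombination (hA : IsSolvablePolynomialAlgebra a b prec)
    (hρ : IsModuleRanking prec ρ) (hg : IsGroebnerBasis b ρ N g x) (z : (Fin n → ℕ) × Fin m) :
    IsLead (monomialBasis b s) ρ (Fintype.linearCombination A g (monomialBasis b m z))
      (leadShift x z) := by
  rw [linearCombination_monomialBasis]
  exact isLead_smul hA hρ z.1 (hg.isLead z.2)

theorem IsGroebnerBasis.linearCombination_mem (hg : IsGroebnerBasis b ρ N g x)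
    (h : Fin m → A) : Fintype.linearCombination A g h ∈ N := by
  rw [Fintype.linearCombination_apply]
  exact N.sum_mem fun j _ => N.smul_mem _ (hg.mem j)

/-- Division by a Gröbner basis. -/
theorem IsGroebnerBasis.exists_linearCombination_eq [WellFoundedLT Ω]
    (hA : IsSolvablePolynomialAlgebra a b prec) (hρ : IsModuleRanking prec ρ)
    (hg : IsGroebnerBasis b ρ N g x) (ω : Ω) :
    ∀ f ∈ N, (∀ y, (monomialBasis b s).repr f y ≠ 0 → ρ y ≤ ω) →
      ∃ h : Fin m → A, Fintype.linearCombination A g h = f ∧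
        ∀ z, (monomialBasis b m).repr h z ≠ 0 → ρ (leadShift x z) ≤ ω := by
  induction ω using WellFoundedLT.induction with
  | ind ω ih =>
  intro f hf hω
  by_cases hf0 : f = 0
  · exact ⟨0, by rw [hf0, map_zero], fun z hz => by simp at hz⟩
  obtain ⟨y, hy⟩ := exists_isLead (B := monomialBasis b s) (ρ := ρ) hf0
  obtain ⟨z, rfl⟩ := hg.exists_leadShift y ⟨f, hf, hy⟩
  obtain ⟨c, hlt⟩ :=
    exists_sub_smul hρ.injective hy (hg.isLead_linearCombination hA hρ z)
  set p := Fintype.linearCombination A g (monomialBasis b m z) with hp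
  have hpN : c • p ∈ N := by
    rw [← algebraMap_smul A c p]
    exact N.smul_mem _ (hg.linearCombination_mem _)
  have hsub : ∃ h : Fin m → A, Fintype.linearCombination A g h = f - c • p ∧
      ∀ z, (monomialBasis b m).repr h z ≠ 0 → ρ (leadShift x z) ≤ ω := by
    by_cases h0 : f - c • p = 0
    · exact ⟨0, by rw [h0, map_zero], fun z hz => by simp at hz⟩
    obtain ⟨y', hy'⟩ := exists_isLead (B := monomialBasis b s) (ρ := ρ) h0
    have hyω := hω _ hy.1
    obtain ⟨h, h1, h2⟩ := ih (ρ y') ((hlt y' hy'.1).trans_le hyω) _ (N.sub_mem hf hpN) hy'.2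
    exact ⟨h, h1, fun z hz => (h2 z hz).trans ((hlt y' hy'.1).trans_le hyω).le⟩
  obtain ⟨h, h1, h2⟩ := hsub
  refine ⟨h + algebraMap K A c • monomialBasis b m z, ?_, fun z' hz' => ?_⟩
  · rw [map_add, h1, map_smul, algebraMap_smul, ← hp, sub_add_cancel]
  · by_cases e : z' = z
    · rw [e]; exact hω _ hy.1
    · refine h2 z' ?_
      rw [algebraMap_smul] at hz'
      simpa [Finsupp.single_apply, Ne.symm e] using hz'

theorem IsGroebnerBasis.exists_linearCombination_eq_of_mem [WellFoundedLT Ω]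
    (hA : IsSolvablePolynomialAlgebra a b prec) (hρ : IsModuleRanking prec ρ)
    (hg : IsGroebnerBasis b ρ N g x) {f : Fin s → A} (hf : f ∈ N) :
    ∃ h : Fin m → A, Fintype.linearCombination A g h = f := by
  by_cases hf0 : f = 0
  · exact ⟨0, by rw [hf0, map_zero]⟩
  obtain ⟨y, hy⟩ := exists_isLead (B := monomialBasis b s) (ρ := ρ) hf0
  obtain ⟨h, h1, -⟩ := hg.exists_linearCombination_eq hA hρ (ρ y) f hf hy.2
  exact ⟨h, h1⟩

/-- The surjection of a free module onto the submodule generated by a Gröbner basis. -/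
noncomputable def IsGroebnerBasis.toLinearMap (hg : IsGroebnerBasis b ρ N g x) :
    (Fin m → A) →ₗ[A] N :=
  (Fintype.linearCombination A g).codRestrict N hg.linearCombination_mem

theorem IsGroebnerBasis.toLinearMap_surjective [WellFoundedLT Ω]
    (hA : IsSolvablePolynomialAlgebra a b prec) (hρ : IsModuleRanking prec ρ)
    (hg : IsGroebnerBasis b ρ N g x) : Function.Surjective hg.toLinearMap := by
  rintro ⟨f, hf⟩
  obtain ⟨h, h1⟩ := hg.exists_linearCombination_eq_of_mem hA hρ hf
  exact ⟨h, Subtype.ext h1⟩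

theorem IsGroebnerBasis.ker_toLinearMap (hg : IsGroebnerBasis b ρ N g x) :
    LinearMap.ker hg.toLinearMap = LinearMap.ker (Fintype.linearCombination A g) :=
  LinearMap.ker_codRestrict _ _ _

/-- If the products `a^α g_j` have pairwise distinct leading indices, the top one in a nonzero
combination cannot cancel. -/
theorem IsGroebnerBasis.toLinearMap_injective
    (hA : IsSolvablePolynomialAlgebra a b prec) (hρ : IsModuleRanking prec ρ)
    (hg : IsGroebnerBasis b ρ N g x) (hx : Function.Injective (leadShift x)) :
    Function.Injective hg.toLinearMap := by
  rw [← LinearMap.ker_eq_bot, hg.ker_toLinearMap, LinearMap.ker_eq_bot']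
  intro h hh
  by_contra h0
  obtain ⟨z, hz⟩ := exists_isLead (B := monomialBasis b m) (ρ := fun z => ρ (leadShift x z)) h0
  have := isLead_map (B := monomialBasis b s) (ρ := ρ) (monomialBasis b m)
    ((Fintype.linearCombination A g).restrictScalars K) (leadShift x)
    (hg.isLead_linearCombination hA hρ) hz.1
    (fun z' h' hne => lt_of_le_of_ne (hz.2 z' h') (hρ.injective.ne (hx.ne hne)))
  apply this.1
  rw [LinearMap.restrictScalars_apply, hh]
  simp

/-! ### Schreyer's ranking and syzygies -/

/-- The ranking of the monomials of `A^m` that is induced by a Gröbner basis with leading indices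
`x`; ties are broken by the `k`-th exponent of `x j`. -/
def schreyerRank (ρ : (Fin n → ℕ) × Fin s → Ω) (x : Fin m → (Fin n → ℕ) × Fin s) (k : Fin n)
    (z : (Fin n → ℕ) × Fin m) : Ω ×ₗ (ℕ ×ₗ Fin m) :=
  toLex (ρ (leadShift x z), toLex ((x z.2).1 k, z.2))

theorem leadShift_add (γ : Fin n → ℕ) (z : (Fin n → ℕ) × Fin m) :
    leadShift x (γ + z.1, z.2) = (γ + (leadShift x z).1, (leadShift x z).2) := by
  simp [leadShift, add_assoc]

theorem isModuleRanking_schreyerRank (hA : IsSolvablePolynomialAlgebra a b prec)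
    (hρ : IsModuleRanking prec ρ) (x : Fin m → (Fin n → ℕ) × Fin s) (k : Fin n) :
    IsModuleRanking prec (schreyerRank ρ x k) where
  injective := by
    rintro ⟨α, i⟩ ⟨β, j⟩ h
    have h' := toLex.injective h
    simp only [Prod.mk.injEq, hρ.injective.eq_iff] at h'
    have hij := congrArg Prod.snd (toLex.injective h'.2)
    simp only at hij
    subst hij
    have := congrArg Prod.fst h'.1
    simp only [leadShift, add_left_inj] at this
    rw [this]
  add_lt γ y z h := by
    rw [schreyerRank, schreyerRank, Prod.Lex.toLex_lt_toLex] at h ⊢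
    simp only [leadShift_add]
    rcases h with h | ⟨h, h'⟩
    · exact Or.inl (hρ.add_lt γ _ _ h)
    · exact Or.inr ⟨by rw [hρ.injective h], h'⟩
  lt_of_prec α β i h := by
    rw [schreyerRank, schreyerRank, Prod.Lex.toLex_lt_toLex]
    refine Or.inl (hρ.lt_of_prec _ _ _ ?_)
    simpa only [add_comm] using hA.add_prec_add (x i).1 h

/-- Leading indices of syzygies arise from overlaps. -/
theorem IsGroebnerBasis.mem_leadSet_ker (hA : IsSolvablePolynomialAlgebra a b prec)
    (hρ : IsModuleRanking prec ρ) (hg : IsGroebnerBasis b ρ N g x) {k : Fin n}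
    {z : (Fin n → ℕ) × Fin m}
    (hz : z ∈ leadSet b (schreyerRank ρ x k) (LinearMap.ker (Fintype.linearCombination A g))) :
    ∃ z', leadShift x z' = leadShift x z ∧
      toLex ((x z'.2).1 k, z'.2) < toLex ((x z.2).1 k, z.2) := by
  obtain ⟨h, hh, hl⟩ := hz
  have hlt : ∀ z', (monomialBasis b m).repr h z' ≠ 0 → z' ≠ z →
      schreyerRank ρ x k z' < schreyerRank ρ x k z := fun z' h' hne =>
    lt_of_le_of_ne (hl.2 z' h') ((isModuleRanking_schreyerRank hA hρ x k).injective.ne hne)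
  -- Without a tie won by `z`, the term at `z` alone would give the top of the image of `h`, which
  -- is zero.
  by_contra! H
  have := isLead_map (B := monomialBasis b s) (ρ := ρ) (monomialBasis b m)
    ((Fintype.linearCombination A g).restrictScalars K) (leadShift x)
    (hg.isLead_linearCombination hA hρ) hl.1
    (fun z' h' hne => by
      have := hlt z' h' hne
      rw [schreyerRank, schreyerRank, Prod.Lex.toLex_lt_toLex] at this
      rcases this with h1 | ⟨h1, h2⟩
      · exact h1
      · exact absurd h2 (H z' (hρ.injective h1)).not_gt)
  apply this.1
  rw [LinearMap.restrictScalars_apply, LinearMap.mem_ker.1 hh]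
  simp

/-- Overlaps give leading indices of syzygies. -/
theorem IsGroebnerBasis.mem_leadSet_ker_of_leadShift_eq [WellFoundedLT Ω]
    (hA : IsSolvablePolynomialAlgebra a b prec)
    (hρ : IsModuleRanking prec ρ) (hg : IsGroebnerBasis b ρ N g x) {k : Fin n}
    {z z' : (Fin n → ℕ) × Fin m} (he : leadShift x z' = leadShift x z)
    (hlt : toLex ((x z'.2).1 k, z'.2) < toLex ((x z.2).1 k, z.2)) :
    z ∈ leadSet b (schreyerRank ρ x k) (LinearMap.ker (Fintype.linearCombination A g)) := by
  set φ := Fintype.linearCombination A g with hφ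
  have h1 := hg.isLead_linearCombination hA hρ z
  have h2 := hg.isLead_linearCombination hA hρ z'
  rw [he] at h2
  -- The S-polynomial of the overlap: dividing it leaves only terms ranked strictly below the tie,
  -- so the resulting syzygy has leading index `z`.
  obtain ⟨c, hc⟩ := exists_sub_smul hρ.injective h1 h2
  have hcφ : φ (monomialBasis b m z) - c • φ (monomialBasis b m z')
      = φ (monomialBasis b m z - algebraMap K A c • monomialBasis b m z') := by
    rw [map_sub, map_smul, algebraMap_smul]
  have hr : ∃ h : Fin m → A, φ h = φ (monomialBasis b m z) - c • φ (monomialBasis b m z') ∧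
      ∀ y, (monomialBasis b m).repr h y ≠ 0 → ρ (leadShift x y) < ρ (leadShift x z) := by
    by_cases h0 : φ (monomialBasis b m z) - c • φ (monomialBasis b m z') = 0
    · exact ⟨0, by rw [h0, map_zero], fun z hz => by simp at hz⟩
    obtain ⟨y, hy⟩ := exists_isLead (B := monomialBasis b s) (ρ := ρ) h0
    obtain ⟨h, h3, h4⟩ := hg.exists_linearCombination_eq hA hρ (ρ y) _
      (by rw [hcφ]; exact hg.linearCombination_mem _) hy.2
    exact ⟨h, h3, fun y' hy' => (h4 y' hy').trans_lt (hc y hy.1)⟩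
  obtain ⟨h, h3, h4⟩ := hr
  have hz' : schreyerRank ρ x k z' < schreyerRank ρ x k z := by
    rw [schreyerRank, schreyerRank, Prod.Lex.toLex_lt_toLex, he]
    exact Or.inr ⟨rfl, hlt⟩
  have hne : z' ≠ z := by rintro rfl; exact lt_irrefl _ hz'
  have hrz : (monomialBasis b m).repr h z = 0 := by
    by_contra h0; exact lt_irrefl _ (h4 z h0)
  refine ⟨monomialBasis b m z - algebraMap K A c • monomialBasis b m z' - h, ?_, ?_, ?_⟩
  · rw [LinearMap.mem_ker, map_sub, h3, hcφ, sub_self]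
  · rw [algebraMap_smul]
    simp [hrz, hne]
  · intro y hy
    by_cases hyz : y = z
    · rw [hyz]
    by_cases hyz' : y = z'
    · rw [hyz']; exact hz'.le
    have : (monomialBasis b m).repr h y ≠ 0 := by
      rw [algebraMap_smul] at hy
      simpa [Finsupp.single_apply, Ne.symm hyz, Ne.symm hyz'] using hy
    rw [schreyerRank, schreyerRank]
    exact (Prod.Lex.toLex_lt_toLex.2 (Or.inl (h4 y this))).le

end Groebner

/-! ### Eliminating one variable per syzygy step -/

/-- Replace the exponents of index `< k` by `0`. -/
def clearBelow (k : ℕ) (α : Fin n → ℕ) : Fin n → ℕ := fun i => if i.1 < k then 0 else α i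

theorem clearBelow_le (k : ℕ) (α : Fin n → ℕ) : clearBelow k α ≤ α := by
  intro i
  unfold clearBelow
  split_ifs
  · exact Nat.zero_le _
  · exact le_rfl

theorem eq_zero_of_minimal {E : Set (Fin n → ℕ)} {k : ℕ}
    (hE : ∀ α ∈ E, clearBelow k α ∈ E) {α : Fin n → ℕ} (hα : Minimal (· ∈ E) α) {i : Fin n}
    (hi : i.1 < k) : α i = 0 := by
  have := hα.2 (hE α hα.1) (clearBelow_le k α) i
  simpa [clearBelow, hi] using this

/-- Here `r + 1` counts the variables that minimal leading exponents may still involve. The ranking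
changes at each step, so `Ω` is quantified inside the induction; `Type 1` accommodates
`Ordinal.{0}`. -/
theorem nonempty_finiteFreeResolution_of_clearBelow {a : Fin n → A}
    (hA : IsSolvablePolynomialAlgebra a b prec) (r : ℕ) :
    ∀ (k : ℕ), k + r + 1 = n → ∀ {s : ℕ} {Ω : Type 1} [LinearOrder Ω] [WellFoundedLT Ω]
      (ρ : (Fin n → ℕ) × Fin s → Ω), IsModuleRanking prec ρ →
      ∀ N : Submodule A (Fin s → A),
      (∀ y ∈ leadSet b ρ N, (clearBelow k y.1, y.2) ∈ leadSet b ρ N) →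
      Nonempty (FiniteFreeResolution.{v, v, v} A N r) := by
  induction r with
  | zero =>
    intro k hk s Ω _ _ ρ hρ N hN
    obtain ⟨m, g, x, hg, hx, hmin⟩ := exists_isGroebnerBasis (b := b) ρ N
    refine ⟨.ofEquiv (LinearEquiv.ofBijective hg.toLinearMap
      ⟨hg.toLinearMap_injective hA hρ ?_, hg.toLinearMap_surjective hA hρ⟩)⟩
    rintro ⟨α, i⟩ ⟨β, j⟩ h
    have h2 : (x i).2 = (x j).2 := (Prod.ext_iff.1 h).2
    have h1 : α + (x i).1 = β + (x j).1 := congrArg Prod.fst h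
    have hz : ∀ l (t : Fin n), t.1 < k → (x l).1 t = 0 := fun l t ht =>
      eq_zero_of_minimal (E := {α | (α, (x l).2) ∈ leadSet b ρ N}) (fun α hα => hN _ hα)
        (hmin l) ht
    -- Now `k = n - 1`: only the last exponent can be nonzero, so minimal exponents in one component
    -- are comparable, hence equal.
    have hle : ∀ i j, (x i).2 = (x j).2 → (x i).1 ⟨k, by omega⟩ ≤ (x j).1 ⟨k, by omega⟩ →
        x i = x j := by
      intro i j h2 h
      have hij : (x i).1 ≤ (x j).1 := by
        intro t
        by_cases ht : t.1 < k
        · rw [hz i t ht]; exact Nat.zero_le _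
        · have : t = ⟨k, by omega⟩ := Fin.ext (by simp only; omega)
          rw [this]; exact h
      have hmi := (hmin i).1
      rw [h2] at hmi
      exact Prod.ext (le_antisymm hij ((hmin j).2 hmi hij)) h2
    have hij : i = j := by
      apply hx
      rcases le_total ((x i).1 ⟨k, by omega⟩) ((x j).1 ⟨k, by omega⟩) with h | h
      · exact hle i j h2 h
      · exact (hle j i h2.symm h).symm
    subst hij
    rw [add_right_cancel h1]
  | succ r ih =>
    intro k hk s Ω _ _ ρ hρ N hN
    obtain ⟨m, g, x, hg, -, hmin⟩ := exists_isGroebnerBasis (b := b) ρ N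
    have hz : ∀ l (t : Fin n), t.1 < k → (x l).1 t = 0 := fun l t ht =>
      eq_zero_of_minimal (E := {α | (α, (x l).2) ∈ leadSet b ρ N}) (fun α hα => hN _ hα)
        (hmin l) ht
    have hkn : k < n := by omega
    obtain ⟨R⟩ := ih (k + 1) (by omega) (schreyerRank ρ x ⟨k, hkn⟩)
      (isModuleRanking_schreyerRank hA hρ x _)
      (LinearMap.ker (Fintype.linearCombination A g)) (by
        rintro ⟨α, j⟩ hy
        obtain ⟨⟨β, l⟩, he, hlt⟩ := hg.mem_leadSet_ker hA hρ hy
        have h1 : β + (x l).1 = α + (x j).1 := congrArg Prod.fst he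
        have h2 : (x l).2 = (x j).2 := (Prod.ext_iff.1 he).2
        -- The overlap survives clearing `α`: below `k` the exponents of `x l` vanish, at `k` the
        -- tie-break bounds them by those of `x j`, and above `k` nothing is cleared.
        have hle : (x l).1 ≤ clearBelow (k + 1) α + (x j).1 := by
          intro t
          rcases lt_trichotomy t.1 k with ht | ht | ht
          · rw [hz l t ht]; exact Nat.zero_le _
          · have : t = ⟨k, hkn⟩ := Fin.ext ht
            rw [this]
            refine le_trans ?_ (Nat.le_add_left _ _)
            rcases Prod.Lex.toLex_lt_toLex.1 hlt with h | h
            · exact h.le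
            · exact h.1.le
          · have := congrFun h1 t
            simp only [Pi.add_apply] at this
            simp only [Pi.add_apply, clearBelow, if_neg (show ¬ t.1 < k + 1 by omega)]
            omega
        refine hg.mem_leadSet_ker_of_leadShift_eq hA hρ
          (z' := (clearBelow (k + 1) α + (x j).1 - (x l).1, l)) ?_ hlt
        exact Prod.ext (tsub_add_cancel_of_le hle) h2)
    exact ⟨.cons hg.toLinearMap (hg.toLinearMap_surjective hA hρ)
      (.congr (LinearEquiv.ofEq _ _ hg.ker_toLinearMap.symm) R)⟩

/-! ### The initial ranking and the conclusion -/

/-- The ranking of the monomials `a^α e_i` of `A^s` by `α` first, then by `i`. -/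
noncomputable def lexRank (prec : (Fin n → ℕ) → (Fin n → ℕ) → Prop)
    [IsWellOrder (Fin n → ℕ) prec] (s : ℕ) (x : (Fin n → ℕ) × Fin s) : Ordinal.{0} ×ₗ Fin s :=
  toLex (IsWellFounded.rank prec x.1, x.2)

theorem isModuleRanking_lexRank {a : Fin n → A} (hA : IsSolvablePolynomialAlgebra a b prec)
    [IsWellOrder (Fin n → ℕ) prec] (s : ℕ) : IsModuleRanking prec (lexRank prec s) where
  injective := by
    rintro ⟨α, i⟩ ⟨β, j⟩ h
    have h' := toLex.injective h
    simpa only [Prod.mk.injEq, rank_injective.eq_iff] using h'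
  add_lt γ y z h := by
    rw [lexRank, lexRank, Prod.Lex.toLex_lt_toLex] at h ⊢
    rcases h with h | ⟨h, h'⟩
    · exact Or.inl (rank_lt_rank_iff.2 (hA.add_prec_add γ (rank_lt_rank_iff.1 h)))
    · exact Or.inr ⟨by rw [rank_injective h], h'⟩
  lt_of_prec α β i h := by
    rw [lexRank, lexRank, Prod.Lex.toLex_lt_toLex]
    exact Or.inl (rank_lt_rank_iff.2 h)

end Solvable

/-- A `K`-algebra whose only basis monomial is `1` is a division ring. -/
theorem isUnit_or_eq_zero_of_basis_subsingleton {K A ι : Type*} [Field K] [Ring A] [Algebra K A]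
    [Subsingleton ι] (b : Basis ι K A) (i : ι) (hi : b i = 1) (x : A) : IsUnit x ∨ x = 0 := by
  have hx : x = algebraMap K A (b.repr x i) := by
    have : Unique ι := ⟨⟨i⟩, fun _ => Subsingleton.elim _ _⟩
    have h := b.sum_repr x
    rw [Fintype.sum_subsingleton _ i, hi, ← Algebra.algebraMap_eq_smul_one] at h
    exact h.symm
  by_cases h : b.repr x i = 0
  · right; rw [hx, h, map_zero]
  · left; rw [hx]; exact (IsUnit.mk0 _ h).map _

theorem theorem3p2p2 {K : Type u} [Field K] {A : Type v} [Ring A] [Algebra K A] {n : ℕ}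
    (a : Fin n → A) (b : Module.Basis (Fin n → ℕ) K A)
    (prec : (Fin n → ℕ) → (Fin n → ℕ) → Prop)
    (hA : IsSolvablePolynomialAlgebra a b prec)
    (M : Type w) [AddCommGroup M] [Module A M] [Module.Finite A M] :
    ∃ q : ℕ, q ≤ n ∧ Nonempty (FiniteFreeResolution.{v, w, v} A M q) := by
  have := hA.isMonomialOrdering.isWellOrder
  refine ⟨n, le_rfl, ?_⟩
  -- The elimination argument needs at least one variable; for `n = 0` the algebra is a division
  -- ring and `M` itself is free.
  cases n with
  | zero =>
    have : Nontrivial A := b.repr.toEquiv.nontrivial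
    let _ : DivisionRing A :=
      .ofIsUnitOrEqZero (isUnit_or_eq_zero_of_basis_subsingleton b 0 hA.basis_zero)
    exact ⟨.ofEquiv (Module.finBasis A M).equivFun.symm⟩
  | succ r =>
    obtain ⟨s, f, hf⟩ := Module.Finite.exists_fin' A M
    obtain ⟨R⟩ := nonempty_finiteFreeResolution_of_clearBelow hA r 0 (by omega)
      (lexRank prec s) (isModuleRanking_lexRank hA s) (LinearMap.ker f) (by
        rintro ⟨α, i⟩ h
        have : clearBelow 0 α = α := by ext t; simp [clearBelow]
        rwa [this])
    exact ⟨.cons f hf R⟩
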